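/- Let $n\in\mathbb N$, $n\ge 1$, let $\alpha\in(0,1)$ and $p\in[1,+\infty]$, and set $$p_\alpha=\frac{p}{1-\alpha+\alpha p}\ \text{ if } p<+\infty,\qquad p_\alpha=\frac1\alpha\ \text{ if } p=+\infty.$$ For a real-valued $f\in L^p(\mathbb R^n)$ let $$|Df|(\mathbb R^n)=\sup\Big\{\int_{\mathbb R^n} f\,\mathrm{div}\,\varphi\,dx:\ \varphi\in C^\infty_c(\mathbb R^n;\mathbb R^n),\ \|\varphi\|_{L^\infty}\le 1\Big\},$$ let $BV^{1,p}(\mathbb R^n)=\{f\in L^p(\mathbb R^n): |Df|(\mathbb R^n)<+\infty\}$, and let $$\mathcal D^\alpha f(x)=\int_{\mathbb R^n}\frac{|f(x+h)-f(x)|}{|h|^{n+\alpha}}\,dh\in[0,+\infty].$$ For a measurable $u\ge 0$ and $q\in(0,+\infty)$ let $\|u\|_{L^{q,\infty}(\mathbb R^n)}=\sup_{t>0}t\,|\{u>t\}|^{1/q}$, and let $L^{q,\infty}(\mathbb R^n)$ be the space of measurable a.e. finite functions for which this quantity (of the absolute value) is finite. Then the operator $\mathcal D^\alpha\colon BV^{1,p}(\mathbb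 R^n)\to L^{p_\alpha,\infty}(\mathbb R^n)$ is well defined: for every $f\in BV^{1,p}(\mathbb R^n)$, the function $\mathcal D^\alpha f$ is, up to null sets, independent of the representative of $f$, and it is measurable, finite a.e. and belongs to $L^{p_\alpha,\infty}(\mathbb R^n)$. Moreover, there is a constant $c_{n,\alpha,p}>0$, depending on $n$, $\alpha$ and $p$ only, such that $$\|\mathcal D^\alpha f\|_{L^{p_\alpha,\infty}(\mathbb R^n)}\le c_{n,\alpha,p}\,\|f\|_{L^p(\mathbb R^n)}^{1-\alpha}\,|Df|(\mathbb R^n)^{\alpha}\qquad\text{for all } f\in BV^{1,p}(\mathbb R^n).$$ -/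

import Mathlib

open MeasureTheory
open scoped ENNReal NNReal ContDiff

noncomputable section

namespace WeakFracBV

/-- The divergence `∑ i, ∂ᵢ φᵢ (x)` of a vector field on `ℝⁿ`. -/
def divergence {n : ℕ} (φ : EuclideanSpace ℝ (Fin n) → EuclideanSpace ℝ (Fin n))
    (x : EuclideanSpace ℝ (Fin n)) : ℝ :=
  ∑ i, (fderiv ℝ φ x (EuclideanSpace.single i 1)) i

/-- The total variation `|Df|(ℝⁿ)`: the supremum of `∫ f div φ` over all `φ ∈ C_c^∞(ℝⁿ; ℝⁿ)` with
`‖φ‖_∞ ≤ 1`. Since `φ = 0` is admissible, truncating the integrals at `0` does not change the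
supremum. -/
def totalVariation {n : ℕ} (f : EuclideanSpace ℝ (Fin n) → ℝ) : ℝ≥0∞ :=
  ⨆ (φ : EuclideanSpace ℝ (Fin n) → EuclideanSpace ℝ (Fin n)) (_ : ContDiff ℝ ∞ φ)
    (_ : HasCompactSupport φ) (_ : ∀ x, ‖φ x‖ ≤ 1),
    ENNReal.ofReal (∫ x, f x * divergence φ x)

/-- `f ∈ BV^{1,p}(ℝⁿ)`: `f ∈ L^p(ℝⁿ)` and `|Df|(ℝⁿ) < ∞`. -/
def MemBV {n : ℕ} (p : ℝ≥0∞) (f : EuclideanSpace ℝ (Fin n) → ℝ) : Prop :=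
  MemLp f p volume ∧ totalVariation f < ⊤

/-- `𝒟^α f (x) = ∫ |f(x+h) - f(x)| / |h|^(n+α) dh`, with values in `[0,∞]`. -/
def fracD {n : ℕ} (α : ℝ) (f : EuclideanSpace ℝ (Fin n) → ℝ)
    (x : EuclideanSpace ℝ (Fin n)) : ℝ≥0∞ :=
  ∫⁻ h : EuclideanSpace ℝ (Fin n), ENNReal.ofReal (|f (x + h) - f x| / ‖h‖ ^ ((n : ℝ) + α))

/-- The weak `L^q` quasinorm `sup_{t > 0} t |{u > t}|^{1/q}` of a function `u ≥ 0`. -/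
def weakNorm {n : ℕ} (q : ℝ) (u : EuclideanSpace ℝ (Fin n) → ℝ≥0∞) : ℝ≥0∞ :=
  ⨆ (t : ℝ≥0) (_ : 0 < t), (t : ℝ≥0∞) * volume {x | (t : ℝ≥0∞) < u x} ^ (1 / q)

/-- `u ∈ L^{q,∞}(ℝⁿ)`, for `u` with values in `[0,∞]`: `u` is Lebesgue measurable, finite almost
everywhere, and has finite weak `L^q` quasinorm. -/
def MemWeakLp {n : ℕ} (q : ℝ) (u : EuclideanSpace ℝ (Fin n) → ℝ≥0∞) : Prop :=
  AEMeasurable u volume ∧ (∀ᵐ x, u x < ⊤) ∧ weakNorm q u < ⊤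

/-- The exponent `p_α = p / (1 - α + α p)` for `p < ∞`, and `p_α = 1 / α` for `p = ∞`. -/
def weakExponent (α : ℝ) (p : ℝ≥0∞) : ℝ :=
  if p = ⊤ then 1 / α else p.toReal / (1 - α + α * p.toReal)

end WeakFracBV

end

/-! Split `fracD` at `‖h‖ = r`. Write `V` for the total variation and `A` for the `L^p` norm of `f`.
Near part: the `L¹` norm of `f (· + h) - f` is at most `V ‖h‖` (`lintegral_enorm_translate_sub_le`),
so Tonelli bounds the `L¹` norm by a multiple of `V r^(1-α)`. Far part: Minkowski's inequality
(`eLpNorm_lintegral_enorm_le`) bounds the `L^p` norm by a multiple of `A r^(-α)`. Chebyshev at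
height `t / 2`, in `L¹` for one part and in `L^p` for the other, controls the superlevel set at `t`.
The `r` that equalizes `V r^(1-α) / t` and `(A r^(-α) / t)^p` produces the exponent `p_α`. For `p =
∞`, `r` is taken so large that the far part is a.e. at most `t / 2`. -/

/-! ### The `L¹` norm by duality with smooth test functions -/

-- The ideal test function is the sign of `g` cut off to a ball. Its mollifications are admissible
-- and converge to it a.e.; dominated convergence passes the bound to the limit, and then the ball
-- exhausts the space.
open Filter Topology Set in
theorem lintegral_enorm_le_of_forall_smooth_test {n : ℕ} {g : EuclideanSpace ℝ (Fin n) → ℝ}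
    (hg : LocallyIntegrable g volume) {C : ℝ}
    (H : ∀ ψ : EuclideanSpace ℝ (Fin n) → ℝ, ContDiff ℝ ∞ ψ → HasCompactSupport ψ →
      (∀ x, |ψ x| ≤ 1) → ∫ x, g x * ψ x ≤ C) :
    ∫⁻ x, ‖g x‖ₑ ≤ ENNReal.ofReal C := by
  suffices hR : ∀ R : ℕ, ∫⁻ x in Metric.ball 0 (R : ℝ), ‖g x‖ₑ ≤ ENNReal.ofReal C by
    have hcov := aecover_ball (μ := (volume : Measure (EuclideanSpace ℝ (Fin n)))) (x := 0)
      (r := fun R : ℕ => (R : ℝ)) tendsto_natCast_atTop_atTop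
    exact le_of_tendsto' (hcov.lintegral_tendsto_of_nat hg.aestronglyMeasurable.enorm) hR
  intro R
  let s : EuclideanSpace ℝ (Fin n) → ℝ :=
    (Metric.ball 0 (R : ℝ)).indicator fun x => Real.sign (g x)
  have hsign : ∀ y : ℝ, |Real.sign y| ≤ 1 := by
    intro y
    rcases Real.sign_apply_eq y with h | h | h <;> simp [h]
  have hs1 : ∀ x, ‖s x‖ ≤ 1 := fun x =>
    (norm_indicator_le_norm_self _ _).trans (hsign _)
  have hsm : AEStronglyMeasurable s volume := by
    refine AEStronglyMeasurable.indicator ?_ Metric.isOpen_ball.measurableSet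
    have : Measurable Real.sign := by
      unfold Real.sign
      exact Measurable.ite measurableSet_Iio measurable_const
        (Measurable.ite measurableSet_Ioi measurable_const measurable_const)
    exact (this.comp_aemeasurable hg.aestronglyMeasurable.aemeasurable).aestronglyMeasurable
  have hsl : LocallyIntegrable s volume :=
    (memLp_top_of_bound hsm 1 (ae_of_all _ hs1)).locallyIntegrable le_top
  -- The ratio 2 of outer to inner radius is fixed, as a.e. convergence of the mollifications
  -- requires; outer radii at most 1 keep all supports in the ball of radius `R + 1`.
  let φ : ℕ → ContDiffBump (0 : EuclideanSpace ℝ (Fin n)) := fun k =>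
    ⟨(1 / 2) * (1 / ((k : ℝ) + 1)), 1 / ((k : ℝ) + 1), by positivity, by
      have : 0 < 1 / ((k : ℝ) + 1) := by positivity
      linarith⟩
  have hφ : Tendsto (fun k => (φ k).rOut) atTop (𝓝 0) := tendsto_one_div_add_atTop_nhds_zero_nat
  have hφ1 : ∀ k, (φ k).rOut ≤ 1 := fun k =>
    (div_le_one₀ (by positivity)).2 (by linarith [Nat.cast_nonneg (α := ℝ) k])
  let ψ : ℕ → EuclideanSpace ℝ (Fin n) → ℝ := fun k =>
    convolution ((φ k).normed volume) s (ContinuousLinearMap.lsmul ℝ ℝ) volume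
  have hlim : ∀ᵐ x, Tendsto (fun k => ψ k x) atTop (𝓝 (s x)) :=
    ContDiffBump.ae_convolution_tendsto_right_of_locallyIntegrable hφ (K := 2)
      (Eventually.of_forall fun k => by
        change 1 / ((k : ℝ) + 1) ≤ 2 * ((1 / 2) * (1 / ((k : ℝ) + 1)))
        linarith) hsl
  have hψs : ∀ k, ContDiff ℝ ∞ (ψ k) := fun k =>
    (φ k).hasCompactSupport_normed.contDiff_convolution_left _ (φ k).contDiff_normed hsl
  have hψ1 : ∀ k x, ‖ψ k x‖ ≤ 1 := fun k x => by
    have := dist_convolution_le (μ := volume) (z₀ := (0 : ℝ)) (g := s) (x₀ := x) zero_le_one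
      (φ k).support_normed_eq.subset (φ k).nonneg_normed (φ k).integral_normed hsm
      (fun y _ => by simpa using hs1 y)
    simpa using this
  have hψ0 : ∀ k x, x ∉ Metric.closedBall 0 ((R : ℝ) + 1) → ψ k x = 0 := fun k x hx => by
    have := dist_convolution_le (μ := volume) (z₀ := (0 : ℝ)) (g := s) (x₀ := x) le_rfl
      (φ k).support_normed_eq.subset (φ k).nonneg_normed (φ k).integral_normed hsm
      (fun y hy => by
        have hy' : y ∉ Metric.ball (0 : EuclideanSpace ℝ (Fin n)) (R : ℝ) := fun h => by
          refine hx ?_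
          have h1 := dist_triangle x y 0
          rw [Metric.mem_ball] at hy h
          rw [dist_comm] at hy
          rw [Metric.mem_closedBall]
          linarith [hφ1 k]
        simp [s, hy'])
    simpa [ψ] using this
  have hψc : ∀ k, HasCompactSupport (ψ k) := fun k =>
    HasCompactSupport.intro (isCompact_closedBall _ _) (hψ0 k)
  have hT := tendsto_integral_of_dominated_convergence
    (F := fun k x => g x * ψ k x) (f := fun x => g x * s x)
    ((Metric.closedBall 0 ((R : ℝ) + 1)).indicator fun x => ‖g x‖)
    (fun k => hg.aestronglyMeasurable.mul (hψs k).continuous.aestronglyMeasurable)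
    ((integrable_indicator_iff Metric.isClosed_closedBall.measurableSet).2
      (hg.integrableOn_isCompact (isCompact_closedBall _ _)).norm)
    (fun k => ae_of_all _ fun x => by
      by_cases hx : x ∈ Metric.closedBall (0 : EuclideanSpace ℝ (Fin n)) ((R : ℝ) + 1)
      · rw [indicator_of_mem hx, norm_mul]
        exact mul_le_of_le_one_right (norm_nonneg _) (hψ1 k x)
      · simp [hψ0 k x hx, hx])
    (hlim.mono fun x hx => hx.const_mul _)
  have hle : ∫ x, g x * s x ≤ C :=
    le_of_tendsto' hT fun k => H (ψ k) (hψs k) (hψc k) (hψ1 k)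
  have hgs : (fun x => g x * s x) =
      (Metric.ball (0 : EuclideanSpace ℝ (Fin n)) (R : ℝ)).indicator fun x => ‖g x‖ := by
    ext x
    by_cases hx : x ∈ Metric.ball (0 : EuclideanSpace ℝ (Fin n)) (R : ℝ)
    · simp only [s, indicator_of_mem hx, Real.norm_eq_abs]
      rcases lt_trichotomy (g x) 0 with h | h | h
      · simp [Real.sign_of_neg h, abs_of_neg h]
      · simp [h]
      · simp [Real.sign_of_pos h, abs_of_pos h]
    · simp [s, hx]
  rw [hgs, integral_indicator Metric.isOpen_ball.measurableSet] at hle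
  have hint : IntegrableOn g (Metric.ball 0 (R : ℝ)) volume :=
    (hg.integrableOn_isCompact (isCompact_closedBall _ _)).mono_set Metric.ball_subset_closedBall
  rw [← ofReal_integral_norm_eq_lintegral_enorm hint]
  exact ENNReal.ofReal_le_ofReal hle

/-! ### Translation estimate for functions of bounded variation -/

namespace WeakFracBV

theorem integral_mul_divergence_le {n : ℕ} {f : EuclideanSpace ℝ (Fin n) → ℝ}
    (hf : totalVariation f < ⊤) {φ : EuclideanSpace ℝ (Fin n) → EuclideanSpace ℝ (Fin n)}
    (hφ : ContDiff ℝ ∞ φ) (hc : HasCompactSupport φ) (h1 : ∀ x, ‖φ x‖ ≤ 1) :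
    ∫ x, f x * divergence φ x ≤ (totalVariation f).toReal := by
  refine (ENNReal.ofReal_le_iff_le_toReal hf.ne).1 ?_
  unfold totalVariation
  exact le_iSup₂_of_le φ hφ (le_iSup₂_of_le hc h1 le_rfl)

theorem divergence_smul_const {n : ℕ} {η : EuclideanSpace ℝ (Fin n) → ℝ}
    (hη : Differentiable ℝ η) (v x : EuclideanSpace ℝ (Fin n)) :
    divergence (fun y => η y • v) x = fderiv ℝ η x v := by
  unfold divergence
  have h := fun i : Fin n => congrArg (fun L => L (EuclideanSpace.single i (1 : ℝ)))
    (((hη x).hasFDerivAt.smul_const v).fderiv)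
  conv_rhs => rw [← (EuclideanSpace.basisFun (Fin n) ℝ).sum_repr v]
  simp only at h
  simp only [h, map_sum, map_smul]
  refine Finset.sum_congr rfl fun i _ => ?_
  simp [mul_comm]

theorem abs_integral_mul_fderiv_le {n : ℕ} {f : EuclideanSpace ℝ (Fin n) → ℝ}
    (hf : totalVariation f < ⊤) {η : EuclideanSpace ℝ (Fin n) → ℝ}
    (hη : ContDiff ℝ ∞ η) (hc : HasCompactSupport η) (h1 : ∀ x, |η x| ≤ 1)
    (v : EuclideanSpace ℝ (Fin n)) :
    |∫ x, f x * fderiv ℝ η x v| ≤ (totalVariation f).toReal * ‖v‖ := by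
  have key : ∀ w : EuclideanSpace ℝ (Fin n), ‖w‖ ≤ 1 →
      ∫ x, f x * fderiv ℝ η x w ≤ (totalVariation f).toReal := fun w hw => by
    have := integral_mul_divergence_le hf (φ := fun y => η y • w) (hη.smul contDiff_const)
      hc.smul_right (fun x => by
        rw [norm_smul]
        exact mul_le_one₀ (h1 x) (norm_nonneg _) hw)
    simpa only [divergence_smul_const (hη.differentiable (by simp))] using this
  rcases eq_or_ne v 0 with rfl | hv
  · simp
  have hv' : 0 < ‖v‖ := norm_pos_iff.2 hv
  have e : ∀ c : ℝ, ∫ x, f x * fderiv ℝ η x (c • v) = c * ∫ x, f x * fderiv ℝ η x v := fun c => by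
    rw [← integral_const_mul]
    congr 1 with x
    simp only [map_smul, smul_eq_mul]
    ring
  have k1 := key (‖v‖⁻¹ • v) (by rw [norm_smul]; simp [hv'.ne'])
  have k2 := key ((-‖v‖⁻¹) • v) (by rw [norm_smul]; simp [hv'.ne'])
  rw [e] at k1 k2
  rw [← div_le_iff₀ hv', ← abs_norm v, ← abs_div, div_eq_inv_mul, abs_le]
  constructor <;> linarith

/-- The derivative of `f ∗ η` in direction `v` is, up to sign, the integral of `f` against a
directional derivative of the admissible function `η (x - ·)`. The mean value inequality concludes.
-/
theorem dist_convolution_le_totalVariation {n : ℕ} {f : EuclideanSpace ℝ (Fin n) → ℝ}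
    (hfl : LocallyIntegrable f volume)
    (hf : totalVariation f < ⊤) {η : EuclideanSpace ℝ (Fin n) → ℝ}
    (hη : ContDiff ℝ ∞ η) (hc : HasCompactSupport η) (h1 : ∀ x, |η x| ≤ 1)
    (y z : EuclideanSpace ℝ (Fin n)) :
    |(∫ t, f t * η (y - t)) - ∫ t, f t * η (z - t)| ≤ (totalVariation f).toReal * ‖y - z‖ := by
  let L := ContinuousLinearMap.mul ℝ ℝ
  have hd := fun x => hc.hasFDerivAt_convolution_right L hfl (hη.of_le (by simp)) x
  refine Convex.norm_image_sub_le_of_norm_hasFDerivWithin_le (𝕜 := ℝ) (s := Set.univ)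
    (f := convolution f η L volume)
    (fun x _ => (hd x).hasFDerivWithinAt) (fun x _ => ?_) convex_univ trivial trivial
  refine ContinuousLinearMap.opNorm_le_bound _ ENNReal.toReal_nonneg fun v => ?_
  have hex : ConvolutionExistsAt f (fderiv ℝ η) x (L.precompR _) volume :=
    (hc.fderiv ℝ).convolutionExists_right _ hfl (hη.continuous_fderiv (by simp)) x
  rw [convolution, ContinuousLinearMap.integral_apply hex]
  have hη' : ContDiff ℝ ∞ fun t => η (x - t) := hη.comp (contDiff_const.sub contDiff_id)
  have := abs_integral_mul_fderiv_le hf hη'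
    (hc.comp_homeomorph (Homeomorph.subLeft x)) (fun t => h1 _) v
  rw [← abs_neg, ← integral_neg] at this
  refine le_of_eq_of_le ?_ this
  rw [Real.norm_eq_abs]
  congr 2 with t
  have hfd : fderiv ℝ (fun t => η (x - t)) t = - fderiv ℝ η (x - t) := by
    have := ((hη.differentiable (by simp)) (x - t)).hasFDerivAt.comp t
      ((hasFDerivAt_const x t).sub (hasFDerivAt_id t))
    refine this.fderiv.trans ?_
    ext w
    simp
  rw [hfd]
  simp [L, ContinuousLinearMap.precompR_apply]

/-- Tested against `ψ`, the difference equals the increment between `0` and `h` of the convolution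
of `f` with the reflection of `ψ`, so no approximation of `f` is needed. -/
theorem lintegral_enorm_translate_sub_le {n : ℕ} {f : EuclideanSpace ℝ (Fin n) → ℝ}
    (hfl : LocallyIntegrable f volume) (hf : totalVariation f < ⊤)
    (h : EuclideanSpace ℝ (Fin n)) :
    ∫⁻ x, ‖f (x + h) - f x‖ₑ ≤ totalVariation f * ‖h‖ₑ := by
  have hmp := measurePreserving_add_right (volume : Measure (EuclideanSpace ℝ (Fin n))) h
  have hflh : LocallyIntegrable (fun x => f (x + h)) volume := by
    refine (locallyIntegrable_map_homeomorph (Homeomorph.addRight h)).1 ?_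
    rwa [Homeomorph.coe_addRight, hmp.map_eq]
  have := lintegral_enorm_le_of_forall_smooth_test (hflh.sub hfl)
    (C := (totalVariation f).toReal * ‖h‖) fun ψ hψ hc h1 => ?_
  · rwa [ENNReal.ofReal_mul ENNReal.toReal_nonneg, ENNReal.ofReal_toReal hf.ne,
      ofReal_norm] at this
  have i1 : Integrable fun x => f (x + h) * ψ x :=
    hflh.integrable_smul_right_of_hasCompactSupport hψ.continuous hc
  have i2 : Integrable fun x => f x * ψ x :=
    hfl.integrable_smul_right_of_hasCompactSupport hψ.continuous hc
  simp only [Pi.sub_apply, sub_mul]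
  rw [integral_sub i1 i2]
  have e : ∫ x, f (x + h) * ψ x = ∫ t, f t * ψ (t - h) := by
    rw [← integral_add_right_eq_self (fun t => f t * ψ (t - h)) h]
    simp
  have := dist_convolution_le_totalVariation hfl hf (η := fun t => ψ (-t))
    (hψ.comp contDiff_neg) (hc.comp_homeomorph (Homeomorph.neg _)) (fun t => h1 _) h 0
  simp only [neg_sub, sub_zero] at this
  rw [e]
  exact (le_abs_self _).trans this

end WeakFracBV

/-! ### Radial integrals of powers -/

namespace WeakFracBV
open Set

theorem lintegral_ofReal_fun_norm {n : ℕ} (hn : 1 ≤ n) {g : ℝ → ℝ}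
    (hg0 : ∀ y, 0 ≤ g y)
    (hg : IntegrableOn (fun y : ℝ => y ^ (n - 1) * g y) (Ioi 0)) :
    ∫⁻ x : EuclideanSpace ℝ (Fin n), ENNReal.ofReal (g ‖x‖) =
      ENNReal.ofReal (n * volume.real (Metric.ball (0 : EuclideanSpace ℝ (Fin n)) 1) *
        ∫ y in Ioi (0 : ℝ), y ^ (n - 1) * g y) := by
  have : Nonempty (Fin n) := ⟨⟨0, hn⟩⟩
  have hi : Integrable (fun x : EuclideanSpace ℝ (Fin n) => g ‖x‖) := by
    rw [integrable_fun_norm_addHaar volume (f := g)]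
    simpa using hg
  rw [← ofReal_integral_eq_lintegral_ofReal hi (ae_of_all _ fun x => hg0 _),
    integral_fun_norm_addHaar]
  simp [mul_assoc]

theorem pow_sub_one_mul_rpow_sub {n : ℕ} (hn : 1 ≤ n) {y : ℝ} (hy : 0 < y) (s : ℝ) :
    y ^ (n - 1) * y ^ (s - n) = y ^ (s - 1) := by
  rw [← Real.rpow_natCast, ← Real.rpow_add hy, Nat.cast_sub hn]
  congr 1
  push_cast
  ring

theorem exists_lintegral_ball_rpow {n : ℕ} (hn : 1 ≤ n) {s : ℝ} (hs : 0 < s) :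
    ∃ C : ℝ, 0 < C ∧ ∀ r : ℝ, 0 < r →
      ∫⁻ h in {h : EuclideanSpace ℝ (Fin n) | ‖h‖ < r}, ENNReal.ofReal (‖h‖ ^ (s - n)) =
        ENNReal.ofReal (C * r ^ s) := by
  have : Nonempty (Fin n) := ⟨⟨0, hn⟩⟩
  have hv : 0 < volume.real (Metric.ball (0 : EuclideanSpace ℝ (Fin n)) 1) :=
    ENNReal.toReal_pos (Metric.measure_ball_pos _ _ one_pos).ne' measure_ball_lt_top.ne
  have hn' : (0 : ℝ) < n := by exact_mod_cast hn
  refine ⟨n * volume.real (Metric.ball (0 : EuclideanSpace ℝ (Fin n)) 1) * (1 / s),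
    by positivity, fun r hr => ?_⟩
  -- `Ico` includes `0` so that the radial profile agrees with the ball indicator at the origin too.
  have heq : ∀ y ∈ Ioi (0 : ℝ), (Ioo 0 r).indicator (fun y => y ^ (s - 1)) y =
      y ^ (n - 1) * (Ico 0 r).indicator (fun y : ℝ => y ^ (s - n)) y := fun y hy => by
    by_cases hyr : y < r
    · rw [indicator_of_mem (mem_Ioo.2 ⟨hy, hyr⟩), indicator_of_mem (mem_Ico.2 ⟨le_of_lt hy, hyr⟩),
        pow_sub_one_mul_rpow_sub hn hy]
    · simp [hyr]
  have hio : IntegrableOn (fun y : ℝ => y ^ (s - 1)) (Ioo 0 r) :=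
    (intervalIntegral.integrableOn_Ioo_rpow_iff hr).2 (by linarith)
  have h1 := lintegral_ofReal_fun_norm hn
    (g := (Ico 0 r).indicator fun y : ℝ => y ^ (s - n))
    (fun y => indicator_nonneg (fun y hy => Real.rpow_nonneg hy.1 _) y)
    ((hio.integrable_indicator measurableSet_Ioo).integrableOn.congr_fun heq measurableSet_Ioi)
  rw [← setIntegral_congr_fun measurableSet_Ioi heq, setIntegral_indicator measurableSet_Ioo,
    inter_eq_right.2 Ioo_subset_Ioi_self, ← integral_Ioc_eq_integral_Ioo,
    ← intervalIntegral.integral_of_le hr.le, integral_rpow (Or.inl (by linarith)),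
    sub_add_cancel, Real.zero_rpow hs.ne', sub_zero] at h1
  rw [← lintegral_indicator (measurableSet_lt measurable_norm measurable_const)]
  calc _ = _ := lintegral_congr fun x => ?_
    _ = _ := h1
    _ = _ := by congr 1; ring
  by_cases hx : ‖x‖ < r <;> simp [indicator, hx]

theorem exists_lintegral_compl_ball_rpow {n : ℕ} (hn : 1 ≤ n) {s : ℝ} (hs : 0 < s) :
    ∃ C : ℝ, 0 < C ∧ ∀ r : ℝ, 0 < r →
      ∫⁻ h in {h : EuclideanSpace ℝ (Fin n) | ‖h‖ < r}ᶜ, ENNReal.ofReal (‖h‖ ^ (-s - n)) =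
        ENNReal.ofReal (C * r ^ (-s)) := by
  have : Nonempty (Fin n) := ⟨⟨0, hn⟩⟩
  have hv : 0 < volume.real (Metric.ball (0 : EuclideanSpace ℝ (Fin n)) 1) :=
    ENNReal.toReal_pos (Metric.measure_ball_pos _ _ one_pos).ne' measure_ball_lt_top.ne
  have hn' : (0 : ℝ) < n := by exact_mod_cast hn
  refine ⟨n * volume.real (Metric.ball (0 : EuclideanSpace ℝ (Fin n)) 1) * (1 / s),
    by positivity, fun r hr => ?_⟩
  have heq : ∀ y ∈ Ioi (0 : ℝ), (Ici r).indicator (fun y => y ^ (-s - 1)) y =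
      y ^ (n - 1) * (Ici r).indicator (fun y : ℝ => y ^ (-s - n)) y := fun y hy => by
    by_cases hyr : r ≤ y
    · rw [indicator_of_mem (mem_Ici.2 hyr), indicator_of_mem (mem_Ici.2 hyr), pow_sub_one_mul_rpow_sub hn hy]
    · simp [hyr]
  have hio : IntegrableOn (fun y : ℝ => y ^ (-s - 1)) (Ici r) :=
    (integrableOn_Ici_iff_integrableOn_Ioi (by simp)).2 (integrableOn_Ioi_rpow_of_lt (by linarith) hr)
  have h1 := lintegral_ofReal_fun_norm hn
    (g := (Ici r).indicator fun y : ℝ => y ^ (-s - n))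
    (fun y => indicator_nonneg (fun y hy => Real.rpow_nonneg (hr.le.trans hy) _) y)
    ((hio.integrable_indicator measurableSet_Ici).integrableOn.congr_fun heq measurableSet_Ioi)
  rw [← setIntegral_congr_fun measurableSet_Ioi heq, setIntegral_indicator measurableSet_Ici,
    inter_eq_right.2 (Ici_subset_Ioi.2 hr), integral_Ici_eq_integral_Ioi,
    integral_Ioi_rpow_of_lt (by linarith) hr, sub_add_cancel] at h1
  rw [← lintegral_indicator (measurableSet_lt measurable_norm measurable_const).compl]
  calc _ = _ := lintegral_congr fun x => ?_
    _ = _ := h1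
    _ = _ := by congr 1; field_simp
  by_cases hx : ‖x‖ < r
  · simp [indicator, hx, not_le.2 hx]
  · simp [indicator, hx, not_lt.1 hx]

end WeakFracBV

/-! ### Minkowski's inequality and the near and far bounds -/

/-- Because the bound `M` is uniform in `y` and `κ` is finite, Hölder in `y` followed by Tonelli
gives the sharp constant when `p < ∞`; for `p = ∞` it suffices to swap the a.e. quantifiers. -/
theorem eLpNorm_lintegral_enorm_le {X Y : Type*} [MeasurableSpace X] [MeasurableSpace Y]
    {μ : Measure X} {κ : Measure Y} [SFinite μ] [IsFiniteMeasure κ] {F : X → Y → ℝ}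
    (hF : Measurable (Function.uncurry F)) {p : ℝ≥0∞} (hp : 1 ≤ p) {M : ℝ≥0∞}
    (hM : ∀ y, eLpNorm (fun x => F x y) p μ ≤ M) :
    eLpNorm (fun x => ∫⁻ y, ‖F x y‖ₑ ∂κ) p μ ≤ M * κ Set.univ := by
  rcases eq_or_ne p ⊤ with rfl | hpt
  · have hs : MeasurableSet {z : X × Y | ‖F z.1 z.2‖ₑ ≤ M} :=
      measurableSet_le hF.enorm measurable_const
    have h1 : ∀ᵐ x ∂μ, ∀ᵐ y ∂κ, ‖F x y‖ₑ ≤ M := by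
      refine (Measure.ae_ae_comm (p := fun x y => ‖F x y‖ₑ ≤ M) hs).2
        (ae_of_all _ fun y => ?_)
      have h2 : eLpNormEssSup (fun x => F x y) μ ≤ M := by simpa using hM y
      exact (ae_le_eLpNormEssSup (f := fun x => F x y)).mono fun x hx => hx.trans h2
    rw [eLpNorm_exponent_top]
    refine essSup_le_of_ae_le _ (h1.mono fun x hx => ?_)
    simpa using lintegral_mono_ae hx
  · have hp0 : p ≠ 0 := (one_pos.trans_le hp).ne'
    have hP : 1 ≤ p.toReal := by
      simpa using ENNReal.toReal_mono hpt hp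
    have hP0 : 0 < p.toReal := one_pos.trans_le hP
    have hx : ∀ x, (∫⁻ y, ‖F x y‖ₑ ∂κ) ^ p.toReal ≤
        (∫⁻ y, ‖F x y‖ₑ ^ p.toReal ∂κ) * κ Set.univ ^ (p.toReal - 1) := fun x => by
      have hm : AEStronglyMeasurable (F x) κ :=
        (hF.comp measurable_prodMk_left).aestronglyMeasurable
      have h := eLpNorm'_le_eLpNorm'_mul_rpow_measure_univ one_pos hP hm
      have h' := ENNReal.rpow_le_rpow h hP0.le
      rw [ENNReal.mul_rpow_of_nonneg _ _ hP0.le, ← lintegral_rpow_enorm_eq_rpow_eLpNorm' hP0,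
        ← ENNReal.rpow_mul] at h'
      convert! h' using 3
      · simp [eLpNorm'_eq_lintegral_enorm]
      · field_simp
    have hM' : ∀ y, ∫⁻ x, ‖F x y‖ₑ ^ p.toReal ∂μ ≤ M ^ p.toReal := fun y => by
      have h := ENNReal.rpow_le_rpow (hM y) hP0.le
      rwa [eLpNorm_eq_eLpNorm' hp0 hpt, ← lintegral_rpow_enorm_eq_rpow_eLpNorm' hP0] at h
    rw [← ENNReal.rpow_le_rpow_iff hP0, eLpNorm_eq_eLpNorm' hp0 hpt,
      ← lintegral_rpow_enorm_eq_rpow_eLpNorm' hP0]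
    calc ∫⁻ x, ‖∫⁻ y, ‖F x y‖ₑ ∂κ‖ₑ ^ p.toReal ∂μ
        ≤ ∫⁻ x, (∫⁻ y, ‖F x y‖ₑ ^ p.toReal ∂κ) * κ Set.univ ^ (p.toReal - 1) ∂μ :=
          lintegral_mono fun x => by simpa using hx x
      _ = (∫⁻ y, ∫⁻ x, ‖F x y‖ₑ ^ p.toReal ∂μ ∂κ) * κ Set.univ ^ (p.toReal - 1) := by
          rw [lintegral_mul_const' _ _
            (ENNReal.rpow_ne_top_of_nonneg (by linarith) (measure_ne_top _ _)),
            lintegral_lintegral_swap (hF.enorm.pow_const _).aemeasurable]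
      _ ≤ (M ^ p.toReal * κ Set.univ) * κ Set.univ ^ (p.toReal - 1) := by
          gcongr
          simpa using lintegral_mono (μ := κ) hM'
      _ = (M * κ Set.univ) ^ p.toReal := by
          rw [ENNReal.mul_rpow_of_nonneg _ _ hP0.le, mul_assoc]
          nth_rw 1 [← ENNReal.rpow_one (κ Set.univ)]
          rw [← ENNReal.rpow_add_of_nonneg _ _ zero_le_one (by linarith), add_sub_cancel]

namespace WeakFracBV

/-- The kernel `|h|^(-(n+α))`. -/
noncomputable def fracKernel {n : ℕ} (α : ℝ) (h : EuclideanSpace ℝ (Fin n)) : ℝ≥0∞ :=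
  ENNReal.ofReal (‖h‖ ^ (-α - n))

theorem measurable_fracKernel {n : ℕ} (α : ℝ) : Measurable (fracKernel (n := n) α) :=
  (measurable_norm.pow_const _).ennreal_ofReal

theorem fracD_eq_lintegral_mul_fracKernel {n : ℕ} (α : ℝ) (f : EuclideanSpace ℝ (Fin n) → ℝ)
    (x : EuclideanSpace ℝ (Fin n)) :
    fracD α f x = ∫⁻ h, ‖f (x + h) - f x‖ₑ * fracKernel α h := by
  refine lintegral_congr fun h => ?_
  rw [fracKernel, ← ofReal_norm, ← ENNReal.ofReal_mul (norm_nonneg _), Real.norm_eq_abs,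
    div_eq_mul_inv, ← Real.rpow_neg (norm_nonneg _)]
  congr 3
  ring

theorem measurable_uncurry_translate_sub {n : ℕ} {f : EuclideanSpace ℝ (Fin n) → ℝ}
    (hf : Measurable f) : Measurable (Function.uncurry fun x h => f (x + h) - f x) :=
  (hf.comp (measurable_fst.add measurable_snd)).sub (hf.comp measurable_fst)

theorem measurable_fracD {n : ℕ} (α : ℝ) {f : EuclideanSpace ℝ (Fin n) → ℝ}
    (hf : Measurable f) : Measurable (fracD α f) := by
  have : fracD α f = fun x => ∫⁻ h, ‖f (x + h) - f x‖ₑ * fracKernel α h :=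
    funext (fracD_eq_lintegral_mul_fracKernel α f)
  rw [this]
  exact Measurable.lintegral_prod_right' (f := fun z : _ × EuclideanSpace ℝ (Fin n) =>
    ‖f (z.1 + z.2) - f z.1‖ₑ * fracKernel α z.2)
    ((measurable_uncurry_translate_sub hf).enorm.mul
      ((measurable_fracKernel α).comp measurable_snd))

theorem lintegral_near_le {n : ℕ} {α : ℝ} {f : EuclideanSpace ℝ (Fin n) → ℝ}
    (hf : Measurable f) {V : ℝ≥0∞} (hV : ∀ h, ∫⁻ x, ‖f (x + h) - f x‖ₑ ≤ V * ‖h‖ₑ)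
    (B : Set (EuclideanSpace ℝ (Fin n))) :
    ∫⁻ x, ∫⁻ h in B, ‖f (x + h) - f x‖ₑ * fracKernel α h ≤
      V * ∫⁻ h in B, ENNReal.ofReal (‖h‖ ^ (1 - α - n)) := by
  rw [lintegral_lintegral_swap ((measurable_uncurry_translate_sub hf).enorm.mul
      ((measurable_fracKernel α).comp measurable_snd)).aemeasurable,
    ← lintegral_const_mul _ (measurable_norm.pow_const _).ennreal_ofReal]
  refine lintegral_mono fun h => ?_
  simp only
  have hm : Measurable fun x => f (x + h) - f x := (hf.comp (measurable_add_const h)).sub hf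
  rw [lintegral_mul_const _ hm.enorm]
  refine (mul_le_mul_left (hV h) _).trans ?_
  rw [mul_assoc]
  gcongr
  rcases eq_or_ne h 0 with rfl | hh
  · simp
  · rw [fracKernel, ← ofReal_norm, ← ENNReal.ofReal_mul (norm_nonneg _)]
    nth_rw 1 [← Real.rpow_one ‖h‖]
    rw [← Real.rpow_add (norm_pos_iff.2 hh)]
    exact le_of_eq (by congr 2; ring)

theorem eLpNorm_far_le {n : ℕ} {α : ℝ} {f : EuclideanSpace ℝ (Fin n) → ℝ}
    (hf : Measurable f) {p : ℝ≥0∞} (hp : 1 ≤ p) (B : Set (EuclideanSpace ℝ (Fin n)))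
    (hB : ∫⁻ h in B, fracKernel α h ≠ ⊤) :
    eLpNorm (fun x => ∫⁻ h in B, ‖f (x + h) - f x‖ₑ * fracKernel α h) p volume ≤
      2 * eLpNorm f p volume * ∫⁻ h in B, fracKernel α h := by
  -- The kernel becomes the finite measure of Minkowski's inequality.
  let κ := (volume.restrict B).withDensity (fracKernel (n := n) α)
  have hκ : κ Set.univ = ∫⁻ h in B, fracKernel α h := by
    simp [κ, withDensity_apply _ MeasurableSet.univ]
  have : IsFiniteMeasure κ := ⟨by rw [hκ]; exact hB.lt_top⟩
  have := eLpNorm_lintegral_enorm_le (μ := volume) (κ := κ)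
    (measurable_uncurry_translate_sub hf) hp (M := 2 * eLpNorm f p volume) fun h => by
      refine (eLpNorm_sub_le (hf.comp (measurable_add_const h)).aestronglyMeasurable
        hf.aestronglyMeasurable hp).trans ?_
      have h1 := eLpNorm_comp_measurePreserving (p := p) hf.aestronglyMeasurable
        (measurePreserving_add_right (volume : Measure (EuclideanSpace ℝ (Fin n))) h)
      rw [two_mul]
      exact add_le_add h1.le le_rfl
  rw [hκ] at this
  refine le_of_eq_of_le ?_ this
  congr 1 with x
  have hm : Measurable fun h => f (x + h) - f x :=
    (measurable_uncurry_translate_sub hf).comp measurable_prodMk_left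
  rw [lintegral_withDensity_eq_lintegral_mul _ (measurable_fracKernel α) hm.enorm]
  simp [mul_comm]

end WeakFracBV

/-! ### Choice of the splitting radius -/

/-- Equating the two left-hand sides gives `r^(1-α+αP) = A^P t^(1-P) / V`; in logarithms the claims
are linear in `a`, `v`, `τ`. -/
theorem Real.exists_rpow_balance {α P A V t : ℝ} (hα0 : 0 < α) (hα1 : α < 1) (hP : 0 < P)
    (hA : 0 < A) (hV : 0 < V) (ht : 0 < t) :
    ∃ r : ℝ, 0 < r ∧
      V * r ^ (1 - α) / t = (A ^ (1 - α) * V ^ α / t) ^ (P / (1 - α + α * P)) ∧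
      (A * r ^ (-α) / t) ^ P = (A ^ (1 - α) * V ^ α / t) ^ (P / (1 - α + α * P)) := by
  have hD : 1 - α + α * P ≠ 0 := by nlinarith
  obtain ⟨a, rfl⟩ : ∃ a, A = Real.exp a := ⟨_, (Real.exp_log hA).symm⟩
  obtain ⟨v, rfl⟩ : ∃ a, V = Real.exp a := ⟨_, (Real.exp_log hV).symm⟩
  obtain ⟨τ, rfl⟩ : ∃ a, t = Real.exp a := ⟨_, (Real.exp_log ht).symm⟩
  refine ⟨Real.exp ((P * a + (1 - P) * τ - v) / (1 - α + α * P)), Real.exp_pos _, ?_, ?_⟩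
  all_goals
    simp only [← Real.exp_mul, ← Real.exp_add, ← Real.exp_sub, Real.exp_eq_exp]
    simp only [div_eq_mul_inv]
    have hi := mul_inv_cancel₀ hD
    generalize (1 - α + α * P)⁻¹ = i at hi ⊢
  · linear_combination (τ - v) * hi
  · linear_combination P * (τ - a) * hi

theorem Real.exists_rpow_balance_top {α c A V t : ℝ} (hα0 : 0 < α)
    (hc : 0 < c) (hA : 0 < A) (hV : 0 < V) (ht : 0 < t) :
    ∃ r : ℝ, 0 < r ∧ c * (A * r ^ (-α)) = t ∧
      V * r ^ (1 - α) / t = c ^ ((1 - α) / α) * (A ^ (1 - α) * V ^ α / t) ^ (1 / α) := by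
  obtain ⟨γ, rfl⟩ : ∃ a, c = Real.exp a := ⟨_, (Real.exp_log hc).symm⟩
  obtain ⟨a, rfl⟩ : ∃ a, A = Real.exp a := ⟨_, (Real.exp_log hA).symm⟩
  obtain ⟨v, rfl⟩ : ∃ a, V = Real.exp a := ⟨_, (Real.exp_log hV).symm⟩
  obtain ⟨τ, rfl⟩ : ∃ a, t = Real.exp a := ⟨_, (Real.exp_log ht).symm⟩
  refine ⟨Real.exp ((γ + a - τ) / α), Real.exp_pos _, ?_, ?_⟩ <;>
  · simp only [← Real.exp_mul, ← Real.exp_add, ← Real.exp_sub]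
    congr 1
    field_simp
    ring

/-! ### The weak-type estimate -/

namespace WeakFracBV

theorem weakExponent_pos {α : ℝ} (hα0 : 0 < α) (hα1 : α < 1) {p : ℝ≥0∞} (hp : 1 ≤ p) :
    0 < weakExponent α p := by
  unfold weakExponent
  split_ifs with h
  · positivity
  · have : 0 < p.toReal := ENNReal.toReal_pos (one_pos.trans_le hp).ne' h
    have : 0 < 1 - α := by linarith
    positivity

theorem exists_measure_lt_fracD_le {n : ℕ} (hn : 1 ≤ n) {α : ℝ} (hα0 : 0 < α) (hα1 : α < 1)
    {p : ℝ≥0∞} (hp : 1 ≤ p) :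
    ∃ K : ℝ, 0 < K ∧ ∀ f : EuclideanSpace ℝ (Fin n) → ℝ, Measurable f →
      ∀ A V t : ℝ, 0 < A → 0 < V → 0 < t → eLpNorm f p volume ≤ ENNReal.ofReal A →
      (∀ h, ∫⁻ x, ‖f (x + h) - f x‖ₑ ≤ ENNReal.ofReal V * ‖h‖ₑ) →
      volume {x | ENNReal.ofReal t < fracD α f x} ≤
        ENNReal.ofReal (K * (A ^ (1 - α) * V ^ α / t) ^ weakExponent α p) := by
  obtain ⟨C₁, hC₁, h₁⟩ := exists_lintegral_ball_rpow hn (sub_pos.2 hα1)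
  obtain ⟨C₂, hC₂, h₂⟩ := exists_lintegral_compl_ball_rpow hn hα0
  let near : (EuclideanSpace ℝ (Fin n) → ℝ) → ℝ → EuclideanSpace ℝ (Fin n) → ℝ≥0∞ :=
    fun f r x => ∫⁻ h in {h | ‖h‖ < r}, ‖f (x + h) - f x‖ₑ * fracKernel α h
  let far : (EuclideanSpace ℝ (Fin n) → ℝ) → ℝ → EuclideanSpace ℝ (Fin n) → ℝ≥0∞ :=
    fun f r x => ∫⁻ h in {h | ‖h‖ < r}ᶜ, ‖f (x + h) - f x‖ₑ * fracKernel α h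
  have hsplit : ∀ f r x, fracD α f x = near f r x + far f r x := fun f r x => by
    rw [fracD_eq_lintegral_mul_fracKernel]
    exact (lintegral_add_compl _ (measurableSet_lt measurable_norm measurable_const)).symm
  have hmeas : ∀ f, Measurable f → ∀ B : Set (EuclideanSpace ℝ (Fin n)),
      Measurable fun x => ∫⁻ h in B, ‖f (x + h) - f x‖ₑ * fracKernel α h := fun f hf B =>
    Measurable.lintegral_prod_right' (f := fun z : _ × EuclideanSpace ℝ (Fin n) =>
      ‖f (z.1 + z.2) - f z.1‖ₑ * fracKernel α z.2)
      ((measurable_uncurry_translate_sub hf).enorm.mul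
        ((measurable_fracKernel α).comp measurable_snd))
  have hnear : ∀ f, Measurable f → ∀ V t r : ℝ, 0 < V → 0 < t → 0 < r →
      (∀ h, ∫⁻ x, ‖f (x + h) - f x‖ₑ ≤ ENNReal.ofReal V * ‖h‖ₑ) →
      volume {x | ENNReal.ofReal (t / 2) ≤ near f r x} ≤
        ENNReal.ofReal (2 * C₁ * (V * r ^ (1 - α) / t)) := fun f hf V t r hV ht hr hfV => by
    refine (meas_ge_le_lintegral_div (hmeas f hf _).aemeasurable
      (by simpa using ht) ENNReal.ofReal_ne_top).trans ?_
    refine (ENNReal.div_le_div_right (lintegral_near_le hf hfV _) _).trans ?_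
    rw [h₁ r hr, ← ENNReal.ofReal_mul hV.le, ← ENNReal.ofReal_div_of_pos (by positivity)]
    exact le_of_eq (by congr 1; field_simp)
  have hfar : ∀ f, Measurable f → ∀ A r : ℝ, 0 < A → 0 < r → eLpNorm f p volume ≤ ENNReal.ofReal A →
      eLpNorm (far f r) p volume ≤ ENNReal.ofReal (2 * C₂ * (A * r ^ (-α))) :=
    fun f hf A r hA hr hfA => by
      have hk : ∫⁻ h in {h : EuclideanSpace ℝ (Fin n) | ‖h‖ < r}ᶜ, fracKernel α h =
        ENNReal.ofReal (C₂ * r ^ (-α)) := h₂ r hr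
      have := eLpNorm_far_le (α := α) hf hp {h | ‖h‖ < r}ᶜ (by rw [hk]; exact ENNReal.ofReal_ne_top)
      refine this.trans ?_
      rw [hk]
      calc _ ≤ 2 * ENNReal.ofReal A * ENNReal.ofReal (C₂ * r ^ (-α)) := by gcongr
        _ = _ := by
          rw [show (2 : ℝ≥0∞) = ENNReal.ofReal 2 by simp, ← ENNReal.ofReal_mul zero_le_two,
            ← ENNReal.ofReal_mul (by positivity)]
          congr 1
          ring
  have hhalf : ∀ {t : ℝ}, 0 < t →
      ENNReal.ofReal t = ENNReal.ofReal (t / 2) + ENNReal.ofReal (t / 2) := fun {t} ht => by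
    rw [← ENNReal.ofReal_add (by positivity) (by positivity), add_halves]
  rcases eq_or_ne p ⊤ with rfl | hpt
  · refine ⟨2 * C₁ * (4 * C₂) ^ ((1 - α) / α), by positivity,
      fun f hf A V t hA hV ht hfA hfV => ?_⟩
    -- With `c = 4 C₂` the essential bound `2 C₂ A r^(-α)` of the far part is exactly `t / 2`, so
    -- a.e. only the near part contributes.
    obtain ⟨r, hr, hr1, hr2⟩ := Real.exists_rpow_balance_top (c := 4 * C₂) hα0 (by positivity)
      hA hV ht
    rw [weakExponent, if_pos rfl, mul_assoc (2 * C₁), ← hr2]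
    refine (measure_mono_ae ?_).trans (hnear f hf V t r hV ht hr hfV)
    have hf' := hfar f hf A r hA hr hfA
    rw [show 2 * C₂ * (A * r ^ (-α)) = t / 2 by linarith, eLpNorm_exponent_top] at hf'
    filter_upwards [ae_le_eLpNormEssSup (f := far f r) (μ := volume)] with x hx hxt
    by_contra hlt
    have hxt' : ENNReal.ofReal t < fracD α f x := hxt
    rw [hsplit f r x, hhalf ht] at hxt'
    refine hxt'.not_ge (add_le_add (not_le.1 hlt).le ?_)
    simpa using hx.trans hf'
  · have hp0 : p ≠ 0 := (one_pos.trans_le hp).ne'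
    have hP0 : 0 < p.toReal := ENNReal.toReal_pos hp0 hpt
    refine ⟨2 * C₁ + (4 * C₂) ^ p.toReal, by positivity,
      fun f hf A V t hA hV ht hfA hfV => ?_⟩
    obtain ⟨r, hr, hr1, hr2⟩ := Real.exists_rpow_balance hα0 hα1 hP0 hA hV ht
    have hsub : {x | ENNReal.ofReal t < fracD α f x} ⊆
        {x | ENNReal.ofReal (t / 2) ≤ near f r x} ∪
          {x | ENNReal.ofReal (t / 2) ≤ ‖far f r x‖ₑ} := fun x hxt => by
      by_contra hlt
      simp only [Set.mem_union, Set.mem_ofPred_eq, not_or, not_le, enorm_eq_self] at hlt hxt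
      rw [hsplit f r x, hhalf ht] at hxt
      exact hxt.not_ge (add_le_add hlt.1.le hlt.2.le)
    have hfar' : volume {x | ENNReal.ofReal (t / 2) ≤ ‖far f r x‖ₑ} ≤
        ENNReal.ofReal ((4 * C₂) ^ p.toReal * (A * r ^ (-α) / t) ^ p.toReal) := by
      refine (meas_ge_le_mul_pow_eLpNorm_enorm volume hp0 hpt
        (hmeas f hf _).aestronglyMeasurable (by simpa using ht) (by simp)).trans ?_
      rw [← ENNReal.mul_rpow_of_nonneg _ _ hP0.le, ← Real.mul_rpow (by positivity) (by positivity),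
        ← ENNReal.ofReal_rpow_of_nonneg (by positivity) hP0.le]
      gcongr
      refine (mul_le_mul_right (hfar f hf A r hA hr hfA) _).trans ?_
      rw [← ENNReal.ofReal_inv_of_pos (by positivity), ← ENNReal.ofReal_mul (by positivity)]
      exact le_of_eq (by congr 1; field_simp; ring)
    refine (measure_mono hsub).trans ((measure_union_le _ _).trans
      ((add_le_add (hnear f hf V t r hV ht hr hfV) hfar').trans ?_))
    rw [weakExponent, if_neg hpt, hr1, hr2, ← ENNReal.ofReal_add (by positivity) (by positivity),
      add_mul]

theorem exists_weakNorm_fracD_le {n : ℕ} (hn : 1 ≤ n) {α : ℝ} (hα0 : 0 < α) (hα1 : α < 1)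
    {p : ℝ≥0∞} (hp : 1 ≤ p) :
    ∃ c : ℝ, 0 < c ∧ ∀ f : EuclideanSpace ℝ (Fin n) → ℝ, Measurable f → MemBV p f →
      weakNorm (weakExponent α p) (fracD α f) ≤
        ENNReal.ofReal c * eLpNorm f p volume ^ (1 - α) * totalVariation f ^ α := by
  obtain ⟨K, hK, h⟩ := exists_measure_lt_fracD_le hn hα0 hα1 hp
  have hq := weakExponent_pos hα0 hα1 hp
  set q := weakExponent α p
  refine ⟨K ^ (1 / q), by positivity, fun f hf hBV => ?_⟩
  obtain ⟨hLp, hTV⟩ := hBV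
  set A := (eLpNorm f p volume).toReal
  set V := (totalVariation f).toReal
  have hA : eLpNorm f p volume = ENNReal.ofReal A := (ENNReal.ofReal_toReal hLp.2.ne).symm
  have hV : totalVariation f = ENNReal.ofReal V := (ENNReal.ofReal_toReal hTV.ne).symm
  have hA0 : 0 ≤ A := ENNReal.toReal_nonneg
  have hV0 : 0 ≤ V := ENNReal.toReal_nonneg
  rw [hA, hV, ENNReal.ofReal_rpow_of_nonneg hA0 (by linarith),
    ENNReal.ofReal_rpow_of_nonneg hV0 hα0.le, ← ENNReal.ofReal_mul (by positivity),
    ← ENNReal.ofReal_mul (by positivity)]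
  refine iSup₂_le fun t ht => ?_
  -- The radius needs `A, V > 0`; both are enlarged by `ε`, and `ε → 0` covers vanishing norms.
  have hcont : Continuous fun ε : ℝ =>
      ENNReal.ofReal (K ^ (1 / q) * (A + ε) ^ (1 - α) * (V + ε) ^ α) := by
    refine ENNReal.continuous_ofReal.comp ((continuous_const.mul ?_).mul ?_)
    · exact (continuous_const.add continuous_id).rpow_const fun _ => Or.inr (by linarith)
    · exact (continuous_const.add continuous_id).rpow_const fun _ => Or.inr hα0.le
  have hlim := (hcont.tendsto 0).mono_left (nhdsWithin_le_nhds (s := Set.Ioi 0))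
  simp only [add_zero] at hlim
  refine ge_of_tendsto hlim (Filter.eventually_of_mem self_mem_nhdsWithin fun ε hε => ?_)
  have hε' : 0 < ε := hε
  have ht' : (0 : ℝ) < t := ht
  have hAε : 0 < A + ε := by positivity
  have hVε : 0 < V + ε := by positivity
  have hm := h f hf (A + ε) (V + ε) t hAε hVε ht'
    (by rw [hA]; exact ENNReal.ofReal_le_ofReal (by linarith)) fun y =>
    (lintegral_enorm_translate_sub_le (hLp.locallyIntegrable hp) hTV y).trans (by
      rw [hV]
      gcongr
      linarith)
  rw [ENNReal.ofReal_coe_nnreal] at hm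
  refine (mul_le_mul_right (ENNReal.rpow_le_rpow hm (by positivity : 0 ≤ 1 / q)) _).trans ?_
  rw [ENNReal.ofReal_rpow_of_nonneg (by positivity) (by positivity),
    Real.mul_rpow hK.le (by positivity), ← Real.rpow_mul (by positivity),
    mul_one_div_cancel hq.ne', Real.rpow_one, ← ENNReal.ofReal_coe_nnreal,
    ← ENNReal.ofReal_mul ht'.le]
  exact le_of_eq (by congr 1; field_simp)

/-! ### Independence of the representative and finiteness a.e. -/

theorem totalVariation_congr_ae {n : ℕ} {f g : EuclideanSpace ℝ (Fin n) → ℝ}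
    (h : f =ᵐ[volume] g) : totalVariation f = totalVariation g := by
  unfold totalVariation
  refine iSup_congr fun φ => iSup_congr fun _ => iSup_congr fun _ => iSup_congr fun _ => ?_
  congr 1
  exact integral_congr_ae (h.mono fun x hx => by simp only [hx])

theorem fracD_congr_ae {n : ℕ} (α : ℝ) {f g : EuclideanSpace ℝ (Fin n) → ℝ}
    (h : f =ᵐ[volume] g) : fracD α f =ᵐ[volume] fracD α g := by
  filter_upwards [h] with x hx
  refine lintegral_congr_ae ?_
  filter_upwards [(measurePreserving_add_left (volume : Measure (EuclideanSpace ℝ (Fin n)))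
    x).quasiMeasurePreserving.ae_eq_comp h] with y hy
  simp only [Function.comp_apply] at hy
  rw [hx, hy]

theorem weakNorm_congr_ae {n : ℕ} (q : ℝ) {u v : EuclideanSpace ℝ (Fin n) → ℝ≥0∞}
    (h : u =ᵐ[volume] v) : weakNorm q u = weakNorm q v := by
  unfold weakNorm
  refine iSup_congr fun t => iSup_congr fun _ => ?_
  congr 2
  exact measure_congr (h.mono fun x hx => by
    change ((t : ℝ≥0∞) < u x) = ((t : ℝ≥0∞) < v x)
    rw [hx])

/-- The set where `u = ∞` lies in every superlevel set, so positive measure would make the quasinorm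
exceed every multiple of a fixed positive number. -/
theorem ae_lt_top_of_weakNorm_lt_top {n : ℕ} {q : ℝ} (hq : 0 < q)
    {u : EuclideanSpace ℝ (Fin n) → ℝ≥0∞} (h : weakNorm q u < ⊤) : ∀ᵐ x, u x < ⊤ := by
  have hbound : ∀ t : ℝ≥0, 0 < t →
      (t : ℝ≥0∞) * volume {x | ¬ u x < ⊤} ^ (1 / q) ≤ weakNorm q u := fun t ht => by
    refine le_trans ?_ (le_iSup₂ (f := fun (t : ℝ≥0) (_ : 0 < t) =>
      (t : ℝ≥0∞) * volume {x | (t : ℝ≥0∞) < u x} ^ (1 / q)) t ht)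
    gcongr with x
    intro hx
    rw [not_lt_top_iff.1 hx]
    exact ENNReal.coe_lt_top
  rw [ae_iff]
  by_contra hne
  have hpow : volume {x | ¬ u x < ⊤} ^ (1 / q) ≠ 0 := by
    rw [Ne, ENNReal.rpow_eq_zero_iff_of_pos (by positivity)]
    exact hne
  obtain ⟨t, ht⟩ := ENNReal.exists_nat_mul_gt hpow h.ne
  have ht0 : 0 < t := Nat.pos_of_ne_zero (by rintro rfl; simp at ht)
  refine (hbound t (by exact_mod_cast ht0)).not_gt ?_
  simpa using ht

end WeakFracBV

theorem mainTheorem7 (n : ℕ) (hn : 1 ≤ n) (α : ℝ) (hα0 : 0 < α) (hα1 : α < 1)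
    (p : ℝ≥0∞) (hp : 1 ≤ p) :
    ∃ c : ℝ, 0 < c ∧ ∀ f : EuclideanSpace ℝ (Fin n) → ℝ, WeakFracBV.MemBV p f →
      (∀ g : EuclideanSpace ℝ (Fin n) → ℝ, g =ᵐ[volume] f →
        WeakFracBV.fracD α g =ᵐ[volume] WeakFracBV.fracD α f) ∧
      WeakFracBV.MemWeakLp (WeakFracBV.weakExponent α p) (WeakFracBV.fracD α f) ∧
      WeakFracBV.weakNorm (WeakFracBV.weakExponent α p) (WeakFracBV.fracD α f) ≤
        ENNReal.ofReal c * eLpNorm f p volume ^ (1 - α) *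
          WeakFracBV.totalVariation f ^ α := by
  obtain ⟨c, hc, h⟩ := WeakFracBV.exists_weakNorm_fracD_le hn hα0 hα1 hp
  refine ⟨c, hc, fun f hf => ⟨fun g hg => WeakFracBV.fracD_congr_ae α hg, ?_⟩⟩
  obtain ⟨hLp, hTV⟩ := hf
  -- Tonelli was applied to Borel functions, so the estimate is proved for a Borel representative
  -- and transferred back.
  obtain ⟨f', hf'm, hff'⟩ := hLp.aestronglyMeasurable.aemeasurable
  have hD := WeakFracBV.fracD_congr_ae α hff'
  have hle := h f' hf'm
    ⟨hLp.ae_eq hff', by rwa [← WeakFracBV.totalVariation_congr_ae hff']⟩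
  rw [← WeakFracBV.totalVariation_congr_ae hff', ← eLpNorm_congr_ae hff',
    ← WeakFracBV.weakNorm_congr_ae _ hD] at hle
  have hfin : WeakFracBV.weakNorm (WeakFracBV.weakExponent α p) (WeakFracBV.fracD α f) < ⊤ :=
    hle.trans_lt (ENNReal.mul_lt_top (ENNReal.mul_lt_top ENNReal.ofReal_lt_top
      (ENNReal.rpow_lt_top_of_nonneg (by linarith) hLp.2.ne))
      (ENNReal.rpow_lt_top_of_nonneg hα0.le hTV.ne))
  exact ⟨⟨⟨_, WeakFracBV.measurable_fracD α hf'm, hD⟩,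
    WeakFracBV.ae_lt_top_of_weakNorm_lt_top (WeakFracBV.weakExponent_pos hα0 hα1 hp) hfin, hfin⟩,
    hle⟩
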